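/- A probabilistic pushdown automaton (pPDA) $\Delta=(Q,\Gamma,\delta)$ has a finite state set $Q$, a finite stack alphabet $\Gamma$ and transitions $pZ \xrightarrow{a} r\alpha$ with $p,r\in Q$, $Z\in\Gamma$, $\alpha\in\Gamma^*$, $|\alpha|\le 2$ and rational weights $a\ge 0$, such that for every $pZ \in Q\times\Gamma$ the weights of the transitions from $pZ$ sum to $1$. It induces a weighted transition system on the configurations $Q\times\Gamma^*$, in which $pZ\beta$ moves to $r\alpha\beta$ with probability $a$ for every transition $pZ \xrightarrow{a} r\alpha$ and every $\beta\in\Gamma^*$. For $pZq\in Q\times\Gamma\times Q$ let $[pZq]=\sum_\pi \mathrm{p}(\pi)$ be the return probability and $\mathsf{E}[pZq]=\sum_\pi \mathrm{p}(\pi)\,|\pi|\in[0,\infty]$ the first termination moment, where $\pi$ ranges over the finite paths from $pZ$ to $q\varepsilon$, $\mathrm{p}(\pi)$ is the product of the transition probabilities along $\pi$ and $|\pi|$ is its number of steps. $\Delta$ is called cPAST if $\mathsf{E}[pZq]/[pZq]<\infty$ for all $pZq$ with $[pZq]>0$. The fundamental system $f$ of $\Delta$ is the monotone map on $[0,\infty]^{Q\times\Gamma\times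 Q}$ given by $$f(x)_{pZq}=\sum_{pZ\xrightarrow{a}q\varepsilon}a+\sum_{pZ\xrightarrow{a}rY}a\,x_{rYq}+\sum_{pZ\xrightarrow{a}rYX}a\sum_{t\in Q}x_{rYt}\,x_{tXq},$$ and $\mu f$ denotes its least fixed point. **Theorem (Complexity of inductive upper bounds).** There is an absolute constant $K$ such that the following holds. Let $\Delta=(Q,\Gamma,\delta)$ be a pPDA with fundamental system $f$, and suppose that $\Delta$ is cPAST. Let $C=\max\{\mathsf{E}[pZq]/[pZq] : [pZq]>0\}$ be its maximal conditional expected runtime and $m=\min\{[pZq] : [pZq]>0\}$ its minimal non-zero return probability (if all $[pZq]$ are zero, put $C=m=1$). Then for every $\varepsilon>0$ there is a vector $u\in\mathbb{Q}_{\ge 0}^{Q\times\Gamma\times Q}$ with $f(u)\le u$ (componentwise) and $\|\mu f-u\|_\infty\le\varepsilon$, such that every entry of $u$ is a quotient of two integers whose total bit-length is at most $$K\cdot\Big(\log C+\log\tfrac1m+\log|Q|+\log|\Gamma|+\max\{0,\log\tfrac1\varepsilon\}+1\Big).$$ -/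

import Mathlib

open scoped NNReal ENNReal NNRat

universe u v

/-! Weighted transition systems `M` over a state space `S`: paths and termination moments. -/

namespace TransitionSystem

variable {S : Type*}

/-- The weight `∏ M (sᵢ, sᵢ₊₁)` of a path `s₀ … s_l`; paths of length zero have weight 1. -/
noncomputable def pathWeight (M : S → S → ℝ≥0∞) : List S → ℝ≥0∞
  | [] => 1
  | [_] => 1
  | s :: t :: π => M s t * pathWeight M (t :: π)

/-- `π` is a proper path between `s` and `F`: it starts in `s`, ends in `F`, and visits `F`
only at its end. (For `s ∈ F` the only such path is `[s]`.) -/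
def IsProperPath (s : S) (F : Set S) (π : List S) : Prop :=
  π.head? = some s ∧ (∃ t ∈ F, π.getLast? = some t) ∧ ∀ x ∈ π.dropLast, x ∉ F

/-- The `k`-th termination moment `E^k[s|F]`: the sum of `p(π) · |π|^k` over all proper paths
between `s` and `F`, where `|π|` is the number of steps and `0^0 = 1`. -/
noncomputable def moment (M : S → S → ℝ≥0∞) (k : ℕ) (s : S) (F : Set S) : ℝ≥0∞ :=
  ∑' π : {π : List S // IsProperPath s F π},
    pathWeight M π.1 * ((π.1.length - 1 : ℕ) : ℝ≥0∞) ^ k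

end TransitionSystem

/-- Words of length at most two over the stack alphabet. -/
inductive StackWord (Γ : Type v) : Type v
  | nil : StackWord Γ
  | one (Y : Γ) : StackWord Γ
  | two (Y X : Γ) : StackWord Γ

/-- A probabilistic pushdown automaton with finite state set `Q` and finite stack alphabet `Γ`.
`δ p Z r α` is the rational weight of the transition that, in state `p` with `Z` on top of the
stack, moves to state `r` and replaces `Z` by `α` (weight 0 if there is no such transition). -/
structure PPDA (Q : Type u) (Γ : Type v) [Fintype Q] [Fintype Γ] where
  δ : Q → Γ → Q → StackWord Γ → ℚ≥0
  sum_eq_one : ∀ p Z, ∑ r, (δ p Z r .nil + ∑ Y, δ p Z r (.one Y)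
    + ∑ Y, ∑ X, δ p Z r (.two Y X)) = 1

namespace PPDA

variable {Q : Type u} {Γ : Type v} [Fintype Q] [Fintype Γ]

/-- The transition weights as extended non-negative reals. -/
noncomputable def wt (Δ : PPDA Q Γ) (p : Q) (Z : Γ) (r : Q) (α : StackWord Γ) : ℝ≥0∞ :=
  ((Δ.δ p Z r α : ℝ≥0) : ℝ≥0∞)

open Classical in
/-- The transition matrix on the configurations `Q × Γ*`: from `pZβ` the automaton moves to
`rαβ` with weight `δ p Z r α`; configurations with empty stack have no outgoing transition. -/
noncomputable def step (Δ : PPDA Q Γ) : Q × List Γ → Q × List Γ → ℝ≥0∞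
  | (_, []), _ => 0
  | (p, Z :: β), (r, γ) =>
      (if γ = β then Δ.wt p Z r .nil else 0)
      + (∑ Y, if γ = Y :: β then Δ.wt p Z r (.one Y) else 0)
      + ∑ Y, ∑ X, if γ = Y :: X :: β then Δ.wt p Z r (.two Y X) else 0

/-- The return probability `[pZq]`: the 0th termination moment from `pZ` to `qε`. -/
noncomputable def returnProb (Δ : PPDA Q Γ) (p : Q) (Z : Γ) (q : Q) : ℝ≥0∞ :=
  TransitionSystem.moment Δ.step 0 (p, [Z]) {(q, [])}

/-- The first termination moment `E[pZq]` from `pZ` to `qε`. -/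
noncomputable def firstMoment (Δ : PPDA Q Γ) (p : Q) (Z : Γ) (q : Q) : ℝ≥0∞ :=
  TransitionSystem.moment Δ.step 1 (p, [Z]) {(q, [])}

/-- The conditional expected runtime `E[pZq] / [pZq]` (only meaningful if `[pZq] ≠ 0`). -/
noncomputable def condRuntime (Δ : PPDA Q Γ) (p : Q) (Z : Γ) (q : Q) : ℝ≥0∞ :=
  Δ.firstMoment p Z q / Δ.returnProb p Z q

/-- `Δ` is cPAST: all conditional expected runtimes that are defined are finite. -/
def IsCPAST (Δ : PPDA Q Γ) : Prop :=
  ∀ p Z q, Δ.returnProb p Z q ≠ 0 → Δ.condRuntime p Z q < ⊤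

/-- The maximal conditional expected runtime `C`, over all `pZq` with `[pZq] ≠ 0`. -/
noncomputable def maxCondRuntime (Δ : PPDA Q Γ) : ℝ≥0∞ :=
  ⨆ (p : Q) (Z : Γ) (q : Q) (_ : Δ.returnProb p Z q ≠ 0), Δ.condRuntime p Z q

/-- The minimal non-zero return probability. -/
noncomputable def minReturnProb (Δ : PPDA Q Γ) : ℝ≥0∞ :=
  ⨅ (p : Q) (Z : Γ) (q : Q) (_ : Δ.returnProb p Z q ≠ 0), Δ.returnProb p Z q

/-- The fundamental polynomial system `f` of `Δ`, as a monotone map on extended non-negative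
vectors indexed by `Q × Γ × Q`. -/
noncomputable def fundamental (Δ : PPDA Q Γ) :
    (Q × Γ × Q → ℝ≥0∞) →o (Q × Γ × Q → ℝ≥0∞) where
  toFun x := fun ⟨p, Z, q⟩ =>
    Δ.wt p Z q .nil
    + (∑ r, ∑ Y, Δ.wt p Z r (.one Y) * x (r, Y, q))
    + ∑ r, ∑ Y, ∑ X, Δ.wt p Z r (.two Y X) * ∑ t, x (r, Y, t) * x (t, X, q)
  monotone' := by
    rintro x y h ⟨p, Z, q⟩
    dsimp only
    gcongr <;> exact h _

/-- The least fixed point `μf` of the fundamental system. -/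
noncomputable def lfp (Δ : PPDA Q Γ) : Q × Γ × Q → ℝ≥0∞ :=
  OrderHom.lfp Δ.fundamental

end PPDA

/-! Write `r` for the vector of return probabilities and `E` for the vector of first moments.
Decomposing runs at the first step and at the moment the top symbol has been consumed shows that `r
= μf` (`lfp_eq_returnVec`) and that `E = r + f'(r) E` (`momentVec_eq`), where `f'(r)` is the linear
part of `f` at `r`.

Thus `E` is a direction in which `f` gains slack. Since `f` is quadratic, `f(r + ηE) = r + η f'(r) E
+ η² B(E)` exactly, with `B` the quadratic part. From `E ≤ C r` follows `B(E) ≤ C² B(r) ≤ C² r`, so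
`f(r + ηE) ≤ (r + ηE) - η r + η² C² r`. For `η` of order `1/C²` the second-order term uses only a
fraction of the slack `η r`.

The remaining slack pays for rounding: every vector between `u = r + ηE` and `(1 + η/12) u` is still
inductive (`IsCPAST.fundamental_le_self`). Non-zero entries of `u` are at least `m`, so rounding up
to multiples of `2⁻ᵏ` with `2⁻ᵏ ≤ η m / 12` suffices. With `η` of order `min(1, ε) / C²`, the
bit-length is linear in `log C + log(1/m) + max(0, log(1/ε)) + 1`. -/

/-! ### Proper paths graded by their number of steps -/

namespace TransitionSystem

variable {S : Type*}

lemma isProperPath_singleton {s t : S} {F : Set S} :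
    IsProperPath s F [t] ↔ t = s ∧ s ∈ F := by
  simp only [IsProperPath]
  constructor
  · rintro ⟨h1, ⟨x, hx, h2⟩, -⟩
    simp at h1 h2
    subst h1 h2
    exact ⟨rfl, hx⟩
  · rintro ⟨rfl, h⟩
    exact ⟨rfl, ⟨t, h, rfl⟩, by simp⟩

lemma isProperPath_cons_cons {s r t : S} {F : Set S} {π : List S} :
    IsProperPath s F (r :: t :: π) ↔ r = s ∧ s ∉ F ∧ IsProperPath t F (t :: π) := by
  simp only [IsProperPath, List.head?_cons, List.getLast?_cons_cons, List.dropLast_cons_cons,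
    List.mem_cons, forall_eq_or_imp, Option.some.injEq, true_and]
  constructor
  · rintro ⟨rfl, h1, h2, h3⟩
    exact ⟨rfl, h2, h1, h3⟩
  · rintro ⟨rfl, h1, h2, h3⟩
    exact ⟨rfl, h2, h1, h3⟩

open Classical in
/-- The total weight of the proper paths with `n` steps between `s` and `F`. -/
noncomputable def pathSum (M : S → S → ℝ≥0∞) (F : Set S) (n : ℕ) (s : S) : ℝ≥0∞ :=
  ∑' π : List S, if IsProperPath s F π ∧ π.length = n + 1 then pathWeight M π else 0

lemma not_isProperPath_nil {s : S} {F : Set S} : ¬ IsProperPath s F [] := by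
  simp [IsProperPath]

lemma pathSum_zero_of_mem (M : S → S → ℝ≥0∞) {F : Set S} {s : S} (hs : s ∈ F) :
    pathSum M F 0 s = 1 := by
  classical
  rw [pathSum, tsum_eq_single [s]]
  · simp [isProperPath_singleton, hs, pathWeight]
  · intro π hπ
    rw [if_neg]
    rintro ⟨h1, h2⟩
    obtain ⟨t, rfl⟩ := List.length_eq_one_iff.1 h2
    rw [isProperPath_singleton] at h1
    exact hπ (by rw [h1.1])

lemma pathSum_zero_of_notMem (M : S → S → ℝ≥0∞) {F : Set S} {s : S} (hs : s ∉ F) :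
    pathSum M F 0 s = 0 := by
  classical
  rw [pathSum, ENNReal.tsum_eq_zero]
  intro π
  rw [if_neg]
  rintro ⟨h1, h2⟩
  obtain ⟨t, rfl⟩ := List.length_eq_one_iff.1 h2
  exact hs (isProperPath_singleton.1 h1).2

lemma pathSum_succ_of_mem (M : S → S → ℝ≥0∞) {F : Set S} {s : S} (hs : s ∈ F) (n : ℕ) :
    pathSum M F (n + 1) s = 0 := by
  classical
  rw [pathSum, ENNReal.tsum_eq_zero]
  rintro (_ | ⟨r, _ | ⟨t, π⟩⟩)
  · simp
  · simp
  · rw [if_neg]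
    rw [isProperPath_cons_cons]
    tauto

/-- First-step decomposition: for `s ∉ F`, removing the head of a proper path leaves a proper path
from the second state. -/
lemma pathSum_succ_of_notMem (M : S → S → ℝ≥0∞) {F : Set S} {s : S} (hs : s ∉ F) (n : ℕ) :
    pathSum M F (n + 1) s = ∑' t, M s t * pathSum M F n t := by
  classical
  have hinj : Function.Injective (fun π : List S => s :: π) := List.cons_injective
  simp only [pathSum, ← ENNReal.tsum_mul_left]
  rw [ENNReal.tsum_comm, ← hinj.tsum_eq]
  · refine tsum_congr fun π => ?_
    obtain _ | ⟨t, π⟩ := π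
    · simp
    · rw [tsum_eq_single t]
      · simp [isProperPath_cons_cons, hs, pathWeight]
      · intro r hr
        rw [if_neg, mul_zero]
        rintro ⟨⟨h, -⟩, -⟩
        simp only [List.head?_cons, Option.some.injEq] at h
        exact hr h.symm
  · rintro (_ | ⟨r, π⟩) h
    · simp at h
    · refine ⟨π, ?_⟩
      have h' : IsProperPath s F (r :: π) := by
        by_contra hn
        simp [hn] at h
      have := h'.1
      simp only [List.head?_cons, Option.some.injEq] at this
      simp [this]

/-- Sums in `ℝ≥0∞` commute, and each proper path, being non-empty, is counted for exactly one `n`.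
-/
lemma moment_eq_tsum_pathSum (M : S → S → ℝ≥0∞) (k : ℕ) (s : S) (F : Set S) :
    moment M k s F = ∑' n : ℕ, pathSum M F n s * (n : ℝ≥0∞) ^ k := by
  classical
  simp only [pathSum, ← ENNReal.tsum_mul_right, moment]
  rw [ENNReal.tsum_comm]
  have := tsum_subtype {π : List S | IsProperPath s F π}
    (fun π => pathWeight M π * ((π.length - 1 : ℕ) : ℝ≥0∞) ^ k)
  refine this.trans (tsum_congr fun π => ?_)
  by_cases h : IsProperPath s F π
  · rw [tsum_eq_single (π.length - 1)]
    · have h0 : π ≠ [] := by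
        rintro rfl
        exact not_isProperPath_nil h
      have : π.length = π.length - 1 + 1 := by
        have := List.length_pos_iff.2 h0
        omega
      simp [h, ← this]
    · intro n hn
      rw [if_neg, zero_mul]
      rintro ⟨-, h2⟩
      omega
  · simp [h]

end TransitionSystem

/-! ### Runs that empty the stack -/

namespace StackWord

variable {Γ : Type v}

/-- The list of letters of a stack word. -/
def toList : StackWord Γ → List Γ
  | .nil => []
  | .one Y => [Y]
  | .two Y X => [Y, X]

/-- Stack words as optional single letters or pairs of letters. -/
def equivOption (Γ : Type v) : StackWord Γ ≃ Option (Γ ⊕ Γ × Γ) where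
  toFun
    | .nil => none
    | .one Y => some (.inl Y)
    | .two Y X => some (.inr (Y, X))
  invFun
    | none => .nil
    | some (.inl Y) => .one Y
    | some (.inr (Y, X)) => .two Y X
  left_inv := by rintro (_ | _ | _) <;> rfl
  right_inv := by rintro (_ | _ | ⟨_, _⟩) <;> rfl

noncomputable instance [Fintype Γ] : Fintype (StackWord Γ) :=
  Fintype.ofEquiv _ (equivOption Γ).symm

lemma sum_eq [Fintype Γ] {A : Type*} [AddCommMonoid A] (g : StackWord Γ → A) :
    ∑ α, g α = g .nil + ∑ Y, g (.one Y) + ∑ Y, ∑ X, g (.two Y X) := by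
  rw [← (equivOption Γ).symm.sum_comp g, Fintype.sum_option, Fintype.sum_sum_type,
    Fintype.sum_prod_type, add_assoc]
  rfl

end StackWord

namespace PPDA

variable {Q : Type u} {Γ : Type v} [Fintype Q] [Fintype Γ]

lemma sum_wt_eq_one (Δ : PPDA Q Γ) (p : Q) (Z : Γ) : ∑ r, ∑ α, Δ.wt p Z r α = 1 := by
  have h : ∑ r, ∑ α, Δ.δ p Z r α = 1 := by
    simpa only [StackWord.sum_eq] using Δ.sum_eq_one p Z
  have h' : ((∑ r, ∑ α, Δ.δ p Z r α : ℚ≥0) : ℝ≥0) = 1 := by rw [h]; simp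
  have h'' := congrArg (fun x : ℝ≥0 => (x : ℝ≥0∞)) h'
  push_cast at h''
  exact h''

lemma tsum_step_cons_mul (Δ : PPDA Q Γ) (p : Q) (Z : Γ) (β : List Γ)
    (g : Q × List Γ → ℝ≥0∞) :
    ∑' c, Δ.step (p, Z :: β) c * g c =
      ∑ r, ∑ α, Δ.wt p Z r α * g (r, α.toList ++ β) := by
  classical
  rw [ENNReal.tsum_prod', tsum_fintype]
  refine Finset.sum_congr rfl fun r _ => ?_
  simp only [step, add_mul, Finset.sum_mul, ite_mul, zero_mul]
  rw [ENNReal.tsum_add, ENNReal.tsum_add, Summable.tsum_finsetSum fun _ _ => ENNReal.summable,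
    Summable.tsum_finsetSum fun _ _ => ENNReal.summable]
  simp only [Summable.tsum_finsetSum fun _ _ => ENNReal.summable]
  simp [tsum_ite_eq, StackWord.sum_eq, StackWord.toList]

open Classical in
/-- The total weight of the paths with `n` steps from `pα` to `qε`. -/
noncomputable def emptyingWeight (Δ : PPDA Q Γ) : ℕ → Q → List Γ → Q → ℝ≥0∞
  | 0, p, [], q => if p = q then 1 else 0
  | 0, _, _ :: _, _ => 0
  | _ + 1, _, [], _ => 0
  | n + 1, p, Z :: β, q =>
    ∑ r, ∑ α : StackWord Γ, Δ.wt p Z r α * Δ.emptyingWeight n r (α.toList ++ β) q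

lemma pathSum_step_eq (Δ : PPDA Q Γ) (q : Q) (n : ℕ) (p : Q) (α : List Γ) :
    TransitionSystem.pathSum Δ.step {(q, [])} n (p, α) = Δ.emptyingWeight n p α q := by
  classical
  induction n generalizing p α with
  | zero =>
    cases α with
    | nil =>
      by_cases h : p = q
      · rw [TransitionSystem.pathSum_zero_of_mem _ (by simp [h])]
        simp [emptyingWeight, h]
      · rw [TransitionSystem.pathSum_zero_of_notMem _ (by simp [h])]
        simp [emptyingWeight, h]
    | cons Z β =>
      rw [TransitionSystem.pathSum_zero_of_notMem _ (by simp)]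
      simp [emptyingWeight]
  | succ n ih =>
    cases α with
    | nil =>
      by_cases h : p = q
      · rw [TransitionSystem.pathSum_succ_of_mem _ (by simp [h])]
        simp [emptyingWeight]
      · rw [TransitionSystem.pathSum_succ_of_notMem _ (by simp [h])]
        simp [emptyingWeight, step]
    | cons Z β =>
      rw [TransitionSystem.pathSum_succ_of_notMem _ (by simp), tsum_step_cons_mul]
      simp [emptyingWeight, ih]

lemma returnProb_eq_tsum (Δ : PPDA Q Γ) (p : Q) (Z : Γ) (q : Q) :
    Δ.returnProb p Z q = ∑' n, Δ.emptyingWeight n p [Z] q := by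
  simp [returnProb, TransitionSystem.moment_eq_tsum_pathSum, pathSum_step_eq]

lemma firstMoment_eq_tsum (Δ : PPDA Q Γ) (p : Q) (Z : Γ) (q : Q) :
    Δ.firstMoment p Z q = ∑' n : ℕ, Δ.emptyingWeight n p [Z] q * n := by
  simp [firstMoment, TransitionSystem.moment_eq_tsum_pathSum, pathSum_step_eq]

/-- A run that empties `α ++ β` splits uniquely at the first moment when `α` has been consumed,
since until then it cannot see `β`; `t` is the state at that moment. -/
lemma emptyingWeight_append (Δ : PPDA Q Γ) (n : ℕ) (p : Q) (α β : List Γ) (q : Q) :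
    Δ.emptyingWeight n p (α ++ β) q = ∑ t, ∑ ij ∈ Finset.HasAntidiagonal.antidiagonal n,
      Δ.emptyingWeight ij.1 p α t * Δ.emptyingWeight ij.2 t β q := by
  classical
  induction n generalizing p α with
  | zero =>
    cases α with
    | nil => simp [emptyingWeight]
    | cons Z α => simp [emptyingWeight]
  | succ n ih =>
    cases α with
    | nil => simp [emptyingWeight, Finset.Nat.antidiagonal_succ]
    | cons Z α =>
      simp only [List.cons_append, Finset.Nat.antidiagonal_succ, Finset.sum_cons, Finset.sum_map,
        emptyingWeight, zero_mul, zero_add, Function.Embedding.prodMap,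
        Function.Embedding.coeFn_mk, Prod.map, Function.Embedding.refl_apply,
        Nat.succ_eq_add_one, ← List.append_assoc, ih, Finset.mul_sum, Finset.sum_mul, mul_assoc]
      calc _ = ∑ r, ∑ t, ∑ γ : StackWord Γ, ∑ ij ∈ Finset.HasAntidiagonal.antidiagonal n,
            Δ.wt p Z r γ * (Δ.emptyingWeight ij.1 r (γ.toList ++ α) t *
              Δ.emptyingWeight ij.2 t β q) :=
            Finset.sum_congr rfl fun r _ => Finset.sum_comm
        _ = _ := by
          rw [Finset.sum_comm]
          refine Finset.sum_congr rfl fun t _ => ?_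
          symm
          rw [Finset.sum_comm]
          refine Finset.sum_congr rfl fun r _ => ?_
          rw [Finset.sum_comm]

/-- The weights of stack concatenations, summed against a function of the length. -/
lemma tsum_emptyingWeight_append (Δ : PPDA Q Γ) (p : Q) (α β : List Γ) (q : Q)
    (g : ℕ → ℝ≥0∞) :
    ∑' n, Δ.emptyingWeight n p (α ++ β) q * g n = ∑ t, ∑' i, ∑' j,
      Δ.emptyingWeight i p α t * Δ.emptyingWeight j t β q * g (i + j) := by
  simp only [emptyingWeight_append, Finset.sum_mul]
  rw [Summable.tsum_finsetSum fun _ _ => ENNReal.summable]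
  refine Finset.sum_congr rfl fun t _ => ?_
  rw [← ENNReal.tsum_prod (f := fun i j => Δ.emptyingWeight i p α t *
    Δ.emptyingWeight j t β q * g (i + j)), ← Finset.HasAntidiagonal.sigmaAntidiagonalEquivProd.tsum_eq,
    ENNReal.tsum_sigma']
  refine tsum_congr fun n => ?_
  rw [tsum_fintype, Finset.univ_eq_attach, ← Finset.sum_attach]
  refine Finset.sum_congr rfl fun ij _ => ?_
  have := Finset.HasAntidiagonal.mem_antidiagonal.1 ij.2
  simp [Finset.HasAntidiagonal.sigmaAntidiagonalEquivProd, this]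

/-! ### Return probabilities as the least fixed point -/

lemma fundamental_apply (Δ : PPDA Q Γ) (x : Q × Γ × Q → ℝ≥0∞) (p : Q) (Z : Γ) (q : Q) :
    Δ.fundamental x (p, Z, q) = Δ.wt p Z q .nil
    + (∑ r, ∑ Y, Δ.wt p Z r (.one Y) * x (r, Y, q))
    + ∑ r, ∑ Y, ∑ X, Δ.wt p Z r (.two Y X) * ∑ t, x (r, Y, t) * x (t, X, q) := rfl

open Classical in
/-- The weight of a stack under an assignment of weights to single stack symbols. -/
noncomputable def stackValue (x : Q × Γ × Q → ℝ≥0∞) : Q → List Γ → Q → ℝ≥0∞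
  | p, [], q => if p = q then 1 else 0
  | p, Z :: β, q => ∑ t, x (p, Z, t) * stackValue x t β q

omit [Fintype Γ] in
lemma stackValue_append (x : Q × Γ × Q → ℝ≥0∞) (p : Q) (α β : List Γ) (q : Q) :
    stackValue x p (α ++ β) q = ∑ t, stackValue x p α t * stackValue x t β q := by
  classical
  induction α generalizing p with
  | nil => simp [stackValue]
  | cons Z α ih =>
    simp only [List.cons_append, stackValue, ih, Finset.mul_sum, Finset.sum_mul, mul_assoc]
    exact Finset.sum_comm

lemma fundamental_eq_sum_stackValue (Δ : PPDA Q Γ) (x : Q × Γ × Q → ℝ≥0∞)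
    (p : Q) (Z : Γ) (q : Q) :
    Δ.fundamental x (p, Z, q) = ∑ r, ∑ α : StackWord Γ, Δ.wt p Z r α *
      stackValue x r α.toList q := by
  classical
  simp [fundamental_apply, StackWord.sum_eq, StackWord.toList, stackValue,
    Finset.sum_add_distrib]

/-- Runs of bounded length stay below every pre-fixed point. The claim covers whole stacks because
the first step may push symbols, which takes the induction out of one-symbol stacks. -/
lemma sum_range_emptyingWeight_le (Δ : PPDA Q Γ) {x : Q × Γ × Q → ℝ≥0∞}
    (hx : Δ.fundamental x ≤ x) (N : ℕ) (p : Q) (α : List Γ) (q : Q) :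
    ∑ n ∈ Finset.range N, Δ.emptyingWeight n p α q ≤ stackValue x p α q := by
  classical
  induction N generalizing p α with
  | zero => simp
  | succ N ih =>
    rw [Finset.sum_range_succ']
    cases α with
    | nil => simp [emptyingWeight, stackValue]
    | cons Z β =>
      simp only [emptyingWeight, add_zero]
      calc _ = ∑ r, ∑ α : StackWord Γ, Δ.wt p Z r α * ∑ n ∈ Finset.range N,
            Δ.emptyingWeight n r (α.toList ++ β) q := by
            rw [Finset.sum_comm]
            refine Finset.sum_congr rfl fun r _ => ?_
            rw [Finset.sum_comm]
            simp only [Finset.mul_sum]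
        _ ≤ ∑ r, ∑ α : StackWord Γ, Δ.wt p Z r α * stackValue x r (α.toList ++ β) q := by
            gcongr
            exact ih _ _
        _ = ∑ t, Δ.fundamental x (p, Z, t) * stackValue x t β q := by
            simp only [stackValue_append, fundamental_eq_sum_stackValue, Finset.mul_sum,
              Finset.sum_mul, mul_assoc]
            symm
            rw [Finset.sum_comm]
            exact Finset.sum_congr rfl fun r _ => Finset.sum_comm
        _ ≤ _ := by
            rw [stackValue]
            gcongr
            exact hx _

lemma sum_range_emptyingWeight_le_one (Δ : PPDA Q Γ) (N : ℕ) (p : Q) (α : List Γ) :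
    ∑ q, ∑ n ∈ Finset.range N, Δ.emptyingWeight n p α q ≤ 1 := by
  classical
  induction N generalizing p α with
  | zero => simp
  | succ N ih =>
    simp only [Finset.sum_range_succ']
    cases α with
    | nil => simp [emptyingWeight]
    | cons Z β =>
      simp only [emptyingWeight, add_zero]
      calc _ = ∑ r, ∑ α : StackWord Γ, Δ.wt p Z r α * ∑ q, ∑ n ∈ Finset.range N,
            Δ.emptyingWeight n r (α.toList ++ β) q := by
            simp only [Finset.mul_sum]
            rw [Finset.sum_congr rfl fun q _ => Finset.sum_comm, Finset.sum_comm]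
            refine Finset.sum_congr rfl fun r _ => ?_
            rw [Finset.sum_congr rfl fun q _ => Finset.sum_comm, Finset.sum_comm]
        _ ≤ ∑ r, ∑ α : StackWord Γ, Δ.wt p Z r α * 1 := by
            gcongr
            exact ih _ _
        _ = 1 := by simp [sum_wt_eq_one]

lemma returnProb_le_one (Δ : PPDA Q Γ) (p : Q) (Z : Γ) (q : Q) : Δ.returnProb p Z q ≤ 1 := by
  rw [returnProb_eq_tsum, ENNReal.tsum_eq_iSup_nat]
  refine iSup_le fun N => le_trans ?_ (Δ.sum_range_emptyingWeight_le_one N p [Z])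
  exact Finset.single_le_sum (f := fun q => ∑ n ∈ Finset.range N, Δ.emptyingWeight n p [Z] q)
    (fun _ _ => zero_le) (Finset.mem_univ q)

lemma returnProb_le_of_fundamental_le (Δ : PPDA Q Γ) {x : Q × Γ × Q → ℝ≥0∞}
    (hx : Δ.fundamental x ≤ x) (p : Q) (Z : Γ) (q : Q) :
    Δ.returnProb p Z q ≤ x (p, Z, q) := by
  classical
  rw [returnProb_eq_tsum, ENNReal.tsum_eq_iSup_nat]
  refine iSup_le fun N => (Δ.sum_range_emptyingWeight_le hx N p [Z] q).trans_eq ?_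
  simp [stackValue]

/-- The vector of return probabilities. -/
noncomputable def returnVec (Δ : PPDA Q Γ) : Q × Γ × Q → ℝ≥0∞ :=
  fun x => Δ.returnProb x.1 x.2.1 x.2.2

/-- The vector of first termination moments. -/
noncomputable def momentVec (Δ : PPDA Q Γ) : Q × Γ × Q → ℝ≥0∞ :=
  fun x => Δ.firstMoment x.1 x.2.1 x.2.2

/-- The linear part of the fundamental system at `x`, evaluated at `y`. -/
noncomputable def derivSystem (Δ : PPDA Q Γ) (x y : Q × Γ × Q → ℝ≥0∞) :
    Q × Γ × Q → ℝ≥0∞ := fun ⟨p, Z, q⟩ =>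
  (∑ r, ∑ Y, Δ.wt p Z r (.one Y) * y (r, Y, q))
    + ∑ r, ∑ Y, ∑ X, Δ.wt p Z r (.two Y X) *
      ∑ t, (y (r, Y, t) * x (t, X, q) + x (r, Y, t) * y (t, X, q))

/-- The quadratic part of the fundamental system. -/
noncomputable def quadSystem (Δ : PPDA Q Γ) (y : Q × Γ × Q → ℝ≥0∞) :
    Q × Γ × Q → ℝ≥0∞ := fun ⟨p, Z, q⟩ =>
  ∑ r, ∑ Y, ∑ X, Δ.wt p Z r (.two Y X) * ∑ t, y (r, Y, t) * y (t, X, q)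

/-! ### Expansion of the fundamental system and the equation for the first moments -/

lemma quadSystem_le_fundamental (Δ : PPDA Q Γ) (x : Q × Γ × Q → ℝ≥0∞) :
    Δ.quadSystem x ≤ Δ.fundamental x := by
  rintro ⟨p, Z, q⟩
  exact le_add_self

lemma quadSystem_mono (Δ : PPDA Q Γ) {x y : Q × Γ × Q → ℝ≥0∞} (h : x ≤ y) :
    Δ.quadSystem x ≤ Δ.quadSystem y := by
  rintro ⟨p, Z, q⟩
  simp only [quadSystem]
  gcongr <;> exact h _

lemma quadSystem_const_mul (Δ : PPDA Q Γ) (c : ℝ≥0∞) (x : Q × Γ × Q → ℝ≥0∞)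
    (i : Q × Γ × Q) :
    Δ.quadSystem (fun i => c * x i) i = c ^ 2 * Δ.quadSystem x i := by
  obtain ⟨p, Z, q⟩ := i
  simp only [quadSystem, Finset.mul_sum]
  congr! 4
  ring_nf

/-- The Taylor expansion is exact because `f` has degree at most two. -/
lemma fundamental_add_const_mul (Δ : PPDA Q Γ) (c : ℝ≥0∞) (x y : Q × Γ × Q → ℝ≥0∞)
    (i : Q × Γ × Q) :
    Δ.fundamental (fun i => x i + c * y i) i =
      Δ.fundamental x i + c * Δ.derivSystem x y i + c ^ 2 * Δ.quadSystem y i := by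
  obtain ⟨p, Z, q⟩ := i
  simp only [fundamental_apply, derivSystem, quadSystem, mul_add, add_mul,
    Finset.sum_add_distrib, Finset.mul_sum, mul_left_comm (Δ.wt _ _ _ _) c]
  ring_nf

/-- Monomials have degree at most two, so scaling by `c ≥ 1` costs at most `c ^ 2`. This controls
the effect of relative rounding errors. -/
lemma fundamental_const_mul_le (Δ : PPDA Q Γ) {c : ℝ≥0∞} (hc : 1 ≤ c)
    (x : Q × Γ × Q → ℝ≥0∞) (i : Q × Γ × Q) :
    Δ.fundamental (fun i => c * x i) i ≤ c ^ 2 * Δ.fundamental x i := by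
  obtain ⟨p, Z, q⟩ := i
  have hc2 : c ≤ c ^ 2 := le_self_pow₀ hc two_ne_zero
  have h1 := le_mul_of_one_le_left (zero_le (a := Δ.wt p Z q .nil)) (hc.trans hc2)
  have h2 : ∑ r, ∑ Y, Δ.wt p Z r (.one Y) * (c * x (r, Y, q)) ≤
      c ^ 2 * ∑ r, ∑ Y, Δ.wt p Z r (.one Y) * x (r, Y, q) := by
    simp only [Finset.mul_sum]
    refine Finset.sum_le_sum fun r _ => Finset.sum_le_sum fun Y _ => ?_
    rw [mul_left_comm]
    gcongr
  have h3 := (Δ.quadSystem_const_mul c x (p, Z, q)).le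
  simp only [fundamental_apply, mul_add]
  exact add_le_add (add_le_add h1 h2) h3

/-- Condition on the first step; the return probability of a two-symbol stack then factors through
the state in which its top symbol is consumed. -/
lemma fundamental_returnVec (Δ : PPDA Q Γ) : Δ.fundamental Δ.returnVec = Δ.returnVec := by
  classical
  funext ⟨p, Z, q⟩
  have key : ∀ (r : Q) (α : StackWord Γ), ∑' n, Δ.emptyingWeight n r α.toList q =
      stackValue Δ.returnVec r α.toList q := by
    intro r α
    cases α with
    | nil =>
      rw [tsum_eq_single 0]
      · simp [StackWord.toList, emptyingWeight, stackValue]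
      · rintro (_ | n) hn
        · exact absurd rfl hn
        · simp [StackWord.toList, emptyingWeight]
    | one Y => simp [StackWord.toList, stackValue, returnVec, returnProb_eq_tsum]
    | two Y X =>
      have := Δ.tsum_emptyingWeight_append r [Y] [X] q (fun _ => 1)
      simp only [mul_one, ENNReal.tsum_mul_left, ENNReal.tsum_mul_right] at this
      simpa [StackWord.toList, stackValue, returnVec, returnProb_eq_tsum] using this
  rw [fundamental_eq_sum_stackValue]
  simp only [← key]
  simp only [returnVec]
  rw [returnProb_eq_tsum, tsum_eq_zero_add' ENNReal.summable]
  simp only [emptyingWeight, zero_add, List.append_nil]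
  rw [Summable.tsum_finsetSum fun _ _ => ENNReal.summable]
  refine Finset.sum_congr rfl fun r _ => ?_
  rw [Summable.tsum_finsetSum fun _ _ => ENNReal.summable]
  simp only [ENNReal.tsum_mul_left]

lemma lfp_eq_returnVec (Δ : PPDA Q Γ) : Δ.lfp = Δ.returnVec := by
  refine le_antisymm (OrderHom.lfp_le _ Δ.fundamental_returnVec.le) fun i => ?_
  exact Δ.returnProb_le_of_fundamental_le (OrderHom.map_lfp Δ.fundamental).le _ _ _

/-- Every path makes a first step, and the expected length of the rest is linear in the
termination moments. -/
lemma momentVec_eq (Δ : PPDA Q Γ) (i : Q × Γ × Q) :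
    Δ.momentVec i = Δ.returnVec i + Δ.derivSystem Δ.returnVec Δ.momentVec i := by
  classical
  obtain ⟨p, Z, q⟩ := i
  have hnil : ∀ r, ∑' n : ℕ, Δ.emptyingWeight n r [] q * n = 0 := by
    intro r
    rw [ENNReal.tsum_eq_zero]
    rintro (_ | n) <;> simp [emptyingWeight]
  have htwo : ∀ r Y X, ∑' n : ℕ, Δ.emptyingWeight n r [Y, X] q * n =
      ∑ t, (Δ.momentVec (r, Y, t) * Δ.returnVec (t, X, q)
        + Δ.returnVec (r, Y, t) * Δ.momentVec (t, X, q)) := by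
    intro r Y X
    refine (Δ.tsum_emptyingWeight_append r [Y] [X] q (fun n => (n : ℝ≥0∞))).trans ?_
    refine Finset.sum_congr rfl fun t _ => ?_
    simp only [momentVec, returnVec, firstMoment_eq_tsum, returnProb_eq_tsum]
    simp only [Nat.cast_add, mul_add, ENNReal.tsum_add]
    congr 1
    · rw [← ENNReal.tsum_mul_right]
      refine tsum_congr fun i => ?_
      rw [← ENNReal.tsum_mul_left]
      exact tsum_congr fun j => by ring
    · rw [← ENNReal.tsum_mul_right]
      refine tsum_congr fun i => ?_
      rw [← ENNReal.tsum_mul_left]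
      exact tsum_congr fun j => by ring
  -- The length `n + 1` is split into `n`, which gives this linear term, and the first step itself,
  -- which contributes `returnVec`.
  have h : Δ.derivSystem Δ.returnVec Δ.momentVec (p, Z, q) =
      ∑' n : ℕ, Δ.emptyingWeight (n + 1) p [Z] q * n := by
    simp only [emptyingWeight, List.append_nil, Finset.sum_mul, mul_assoc]
    rw [Summable.tsum_finsetSum fun _ _ => ENNReal.summable, derivSystem,
      ← Finset.sum_add_distrib]
    refine Finset.sum_congr rfl fun r _ => ?_
    rw [Summable.tsum_finsetSum fun _ _ => ENNReal.summable]
    simp only [ENNReal.tsum_mul_left, StackWord.sum_eq, StackWord.toList, hnil, htwo,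
      mul_zero, zero_add]
    simp only [momentVec, firstMoment_eq_tsum]
  rw [h]
  simp only [momentVec, returnVec, firstMoment_eq_tsum, returnProb_eq_tsum]
  rw [tsum_eq_zero_add' ENNReal.summable,
    tsum_eq_zero_add' (f := fun n => Δ.emptyingWeight n p [Z] q) ENNReal.summable]
  simp only [emptyingWeight, zero_mul, zero_add, Nat.cast_add, Nat.cast_one, mul_add, mul_one,
    ENNReal.tsum_add]
  exact add_comm _ _

end PPDA

/-! ### Dyadic rounding and the slack inequality -/

/-- Transfers size bounds from an arbitrary representation, here a dyadic one, to lowest terms. -/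
lemma NNRat.num_dvd_den_dvd_of_eq_div {a : ℚ≥0} {n d : ℕ} (hd : d ≠ 0)
    (h : a = (n : ℚ≥0) / d) : a.num ∣ n ∧ a.den ∣ d := by
  have hd' : (d : ℚ≥0) ≠ 0 := by exact_mod_cast hd
  have hden : (a.den : ℚ≥0) ≠ 0 := by exact_mod_cast a.den_ne_zero
  have h1 : (a.num : ℚ≥0) / a.den = n / d := by rw [NNRat.num_div_den, h]
  rw [div_eq_div_iff hden hd'] at h1
  have h2 : a.num * d = n * a.den := by exact_mod_cast h1
  constructor
  · exact a.coprime_num_den.dvd_of_dvd_mul_right (Dvd.intro _ h2)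
  · exact a.coprime_num_den.symm.dvd_of_dvd_mul_left (Dvd.intro_left _ h2.symm)

/-- Rounding up to a multiple of `2⁻ᵏ`. -/
lemma exists_nnrat_round_up {x : ℝ} (h0 : 0 ≤ x) (h2 : x ≤ 2) (k : ℕ) :
    ∃ a : ℚ≥0, x ≤ a ∧ (a : ℝ) ≤ x + 1 / 2 ^ k ∧ Nat.size a.num + Nat.size a.den ≤ 2 * k + 3 := by
  have hk : (0 : ℝ) < 2 ^ k := by positivity
  refine ⟨(⌈x * 2 ^ k⌉₊ : ℚ≥0) / (2 ^ k : ℕ), ?_, ?_, ?_⟩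
  · push_cast
    rw [le_div_iff₀ hk]
    exact Nat.le_ceil _
  · push_cast
    rw [div_le_iff₀ hk, add_mul, one_div, inv_mul_cancel₀ hk.ne']
    exact (Nat.ceil_lt_add_one (by positivity)).le
  · obtain ⟨h3, h4⟩ := NNRat.num_dvd_den_dvd_of_eq_div (pow_ne_zero k two_ne_zero)
      (rfl : (⌈x * 2 ^ k⌉₊ : ℚ≥0) / (2 ^ k : ℕ) = _)
    have h5 : ⌈x * 2 ^ k⌉₊ ≤ 2 ^ (k + 1) := by
      rw [Nat.ceil_le]
      push_cast
      rw [pow_succ]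
      nlinarith
    have h6 := Nat.le_of_dvd (by positivity) h4
    have hnum : Nat.size ((⌈x * 2 ^ k⌉₊ : ℚ≥0) / (2 ^ k : ℕ)).num ≤ k + 2 := by
      rw [Nat.size_le, pow_succ]
      have : ((⌈x * 2 ^ k⌉₊ : ℚ≥0) / (2 ^ k : ℕ)).num ≤ ⌈x * 2 ^ k⌉₊ := by
        by_cases hc : ⌈x * 2 ^ k⌉₊ = 0
        · simp [hc]
        · exact Nat.le_of_dvd (Nat.pos_of_ne_zero hc) h3
      have := Nat.one_le_two_pow (n := k + 1)
      omega
    have hden : Nat.size ((⌈x * 2 ^ k⌉₊ : ℚ≥0) / (2 ^ k : ℕ)).den ≤ k + 1 := by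
      rw [Nat.size_le, pow_succ]
      have := Nat.one_le_two_pow (n := k)
      omega
    omega

/-- Relative rounding slack of `η / 12` is absorbed by the inductive slack at `r + η (r + d)`. -/
lemma sq_one_add_mul_le {r d C η : ℝ} (hr : 0 ≤ r) (hd : 0 ≤ d) (hC : 1 ≤ C) (hη : 0 ≤ η)
    (hηC : η * C ^ 2 ≤ 1 / 6) (hrd : r + d ≤ C * r) :
    (1 + η / 12) ^ 2 * (r + η * d + η ^ 2 * C ^ 2 * r) ≤ r + η * (r + d) := by
  have hC2 : C ≤ C ^ 2 := by nlinarith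
  have h1 : η ≤ 1 / 6 := by nlinarith
  have h2 : η * d ≤ 1 / 6 * r := by
    calc η * d ≤ η * (C ^ 2 * r) := by
          gcongr
          nlinarith
      _ = (η * C ^ 2) * r := by ring
      _ ≤ _ := by gcongr
  have h3 : η ^ 2 * C ^ 2 * r ≤ η * r / 6 := by
    calc η ^ 2 * C ^ 2 * r = (η * r) * (η * C ^ 2) := by ring
      _ ≤ (η * r) * (1 / 6) := by gcongr
      _ = _ := by ring
  have h4 : (1 + η / 12) ^ 2 ≤ 1 + η / 4 := by nlinarith
  have h5 : 0 ≤ η * r := by positivity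
  -- Beyond `r + η d`, the product costs at most `1/4 + 1/24 + 1/6 + 1/144 < 1` times `η r`.
  calc _ ≤ (1 + η / 4) * (r + η * d + η * r / 6) := by gcongr
    _ ≤ _ := by nlinarith [mul_le_mul_of_nonneg_left h2 hη, mul_le_mul_of_nonneg_right h1 h5]

/-! ### Conditional runtimes and inductive upper bounds -/

namespace PPDA

variable {Q : Type u} {Γ : Type v} [Fintype Q] [Fintype Γ]

lemma returnVec_le_momentVec (Δ : PPDA Q Γ) : Δ.returnVec ≤ Δ.momentVec := by
  intro i
  rw [momentVec_eq]
  exact le_self_add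

lemma momentVec_eq_zero (Δ : PPDA Q Γ) {i : Q × Γ × Q} (h : Δ.returnVec i = 0) :
    Δ.momentVec i = 0 := by
  simp only [returnVec, returnProb_eq_tsum, ENNReal.tsum_eq_zero] at h
  simp [momentVec, firstMoment_eq_tsum, h]

lemma returnVec_le_one (Δ : PPDA Q Γ) (i : Q × Γ × Q) : Δ.returnVec i ≤ 1 :=
  Δ.returnProb_le_one _ _ _

lemma returnVec_ne_top (Δ : PPDA Q Γ) (i : Q × Γ × Q) : Δ.returnVec i ≠ ⊤ :=
  ne_top_of_le_ne_top ENNReal.one_ne_top (Δ.returnVec_le_one i)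

/-- The supremum defining `C` skips triples with return probability zero, but there the moment
vanishes too. -/
lemma momentVec_le (Δ : PPDA Q Γ) (i : Q × Γ × Q) :
    Δ.momentVec i ≤ Δ.maxCondRuntime * Δ.returnVec i := by
  by_cases h : Δ.returnVec i = 0
  · simp [h, Δ.momentVec_eq_zero h]
  · rw [← ENNReal.div_le_iff h (Δ.returnVec_ne_top i)]
    exact le_iSup₂_of_le i.1 i.2.1 (le_iSup₂_of_le i.2.2 h le_rfl)

lemma one_le_maxCondRuntime (Δ : PPDA Q Γ) {i : Q × Γ × Q} (h : Δ.returnVec i ≠ 0) :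
    1 ≤ Δ.maxCondRuntime := by
  have h1 := (Δ.returnVec_le_momentVec i).trans (Δ.momentVec_le i)
  rw [← ENNReal.div_le_iff h (Δ.returnVec_ne_top i), ENNReal.div_self h (Δ.returnVec_ne_top i)]
    at h1
  exact h1

/-- cPAST bounds each ratio separately; finiteness of `Q × Γ × Q` makes the bound uniform. -/
lemma IsCPAST.maxCondRuntime_ne_top {Δ : PPDA Q Γ} (hΔ : Δ.IsCPAST) :
    Δ.maxCondRuntime ≠ ⊤ := by
  classical
  refine ne_of_lt (lt_of_le_of_lt ?_ ((Finset.sup_lt_iff ENNReal.zero_lt_top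
    (s := Finset.univ.filter fun i : Q × Γ × Q => Δ.returnProb i.1 i.2.1 i.2.2 ≠ 0)
    (f := fun i => Δ.condRuntime i.1 i.2.1 i.2.2)).2 fun i hi => ?_))
  · exact iSup_le fun p => iSup_le fun Z => iSup_le fun q => iSup_le fun h =>
      Finset.le_sup (f := fun i : Q × Γ × Q => Δ.condRuntime i.1 i.2.1 i.2.2)
        (b := (p, Z, q)) (by simpa using h)
  · exact hΔ _ _ _ (Finset.mem_filter.1 hi).2

lemma minReturnProb_pos (Δ : PPDA Q Γ) : 0 < Δ.minReturnProb := by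
  classical
  refine lt_of_lt_of_le ((Finset.lt_inf_iff ENNReal.zero_lt_top
    (s := Finset.univ.filter fun i : Q × Γ × Q => Δ.returnProb i.1 i.2.1 i.2.2 ≠ 0)
    (f := fun i => Δ.returnProb i.1 i.2.1 i.2.2)).2 fun i hi => ?_) ?_
  · exact pos_iff_ne_zero.2 (Finset.mem_filter.1 hi).2
  · exact le_iInf fun p => le_iInf fun Z => le_iInf fun q => le_iInf fun h =>
      Finset.inf_le (f := fun i : Q × Γ × Q => Δ.returnProb i.1 i.2.1 i.2.2)
        (b := (p, Z, q)) (by simpa using h)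

lemma minReturnProb_le (Δ : PPDA Q Γ) {i : Q × Γ × Q} (h : Δ.returnVec i ≠ 0) :
    Δ.minReturnProb ≤ Δ.returnVec i :=
  iInf₂_le_of_le i.1 i.2.1 (iInf₂_le_of_le i.2.2 h le_rfl)

/-- The fundamental system at a point obtained from the least fixed point by moving in the
direction of the termination moments. -/
lemma fundamental_returnVec_add_le (Δ : PPDA Q Γ) (η : ℝ≥0∞) (i : Q × Γ × Q) :
    Δ.fundamental (fun i => Δ.returnVec i + η * Δ.momentVec i) i ≤ Δ.returnVec i
      + η * Δ.derivSystem Δ.returnVec Δ.momentVec i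
      + η ^ 2 * Δ.maxCondRuntime ^ 2 * Δ.returnVec i := by
  rw [fundamental_add_const_mul, fundamental_returnVec, mul_assoc]
  gcongr
  calc Δ.quadSystem Δ.momentVec i
      ≤ Δ.quadSystem (fun i => Δ.maxCondRuntime * Δ.returnVec i) i :=
        Δ.quadSystem_mono Δ.momentVec_le i
    _ = Δ.maxCondRuntime ^ 2 * Δ.quadSystem Δ.returnVec i := Δ.quadSystem_const_mul _ _ _
    _ ≤ _ := by
        gcongr
        exact (Δ.quadSystem_le_fundamental _ i).trans_eq (by rw [fundamental_returnVec])

/-- Every vector between `u = [·] + η E[·]` and `(1 + η/12) u` is an inductive upper bound,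
provided that `η` is small compared to the conditional runtimes. -/
lemma IsCPAST.fundamental_le_self {Δ : PPDA Q Γ} (hΔ : Δ.IsCPAST) {η : ℝ} (hη : 0 ≤ η)
    (hηC : η * Δ.maxCondRuntime.toReal ^ 2 ≤ 1 / 6) {a : Q × Γ × Q → ℝ≥0∞}
    (ha : ∀ i, Δ.returnVec i + ENNReal.ofReal η * Δ.momentVec i ≤ a i)
    (ha' : ∀ i, a i ≤ ENNReal.ofReal (1 + η / 12) *
      (Δ.returnVec i + ENNReal.ofReal η * Δ.momentVec i)) :
    Δ.fundamental a ≤ a := by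
  intro i
  refine le_trans ?_ (ha i)
  have hρ : 1 ≤ ENNReal.ofReal (1 + η / 12) := by
    rw [ENNReal.one_le_ofReal]
    linarith
  -- With `ρ = 1 + η/12`, the chain is `f(a) ≤ f(ρ u) ≤ ρ² f(u)`, followed by the bound on `f(u)`;
  -- it remains to compare with `u`, entry by entry.
  refine ((Δ.fundamental.monotone ha') i).trans ((Δ.fundamental_const_mul_le hρ _ i).trans
    ((mul_le_mul_right (Δ.fundamental_returnVec_add_le _ i) _).trans ?_))
  have hE := Δ.momentVec_eq i
  have hEC := Δ.momentVec_le i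
  by_cases hR : Δ.returnVec i = 0
  · have h0 := Δ.momentVec_eq_zero hR
    rw [h0, hR, zero_add] at hE
    simp [hR, h0, ← hE]
  have hC1 := Δ.one_le_maxCondRuntime hR
  rw [hE] at hEC ⊢
  have hRt := Δ.returnVec_ne_top i
  have hCt := hΔ.maxCondRuntime_ne_top
  have hDt : Δ.derivSystem Δ.returnVec Δ.momentVec i ≠ ⊤ :=
    ne_top_of_le_ne_top (ENNReal.mul_ne_top hCt hRt) (le_add_self.trans hEC)
  generalize Δ.derivSystem Δ.returnVec Δ.momentVec i = D at *
  generalize Δ.returnVec i = R at *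
  generalize Δ.maxCondRuntime = C at *
  lift D to ℝ≥0 using hDt
  lift R to ℝ≥0 using hRt
  lift C to ℝ≥0 using hCt
  lift η to ℝ≥0 using hη
  have h1 : (1 : ℝ) + (η : ℝ) / 12 = ((1 + η / 12 : ℝ≥0) : ℝ) := by push_cast; rfl
  rw [h1, ENNReal.ofReal_coe_nnreal, ENNReal.ofReal_coe_nnreal]
  norm_cast at hC1 hEC ⊢
  have := sq_one_add_mul_le R.2 D.2 (C := C) (η := η) (by exact_mod_cast hC1) η.2
    (by simpa using hηC) (by exact_mod_cast hEC)
  rw [← NNReal.coe_le_coe]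
  push_cast
  exact this

end PPDA

/-! ### Choice of parameters and the size bound -/

theorem theorem9 :
    ∃ K : ℝ, ∀ (Q : Type u) (Γ : Type v) [Fintype Q] [Fintype Γ] (Δ : PPDA Q Γ),
      Δ.IsCPAST → ∀ ε : ℝ, 0 < ε →
        ∃ a : Q × Γ × Q → ℚ≥0,
          Δ.fundamental (fun x => ((a x : ℝ≥0) : ℝ≥0∞)) ≤ (fun x => ((a x : ℝ≥0) : ℝ≥0∞)) ∧
          (∀ x, Δ.lfp x ≠ ⊤) ∧
          ‖fun x => (Δ.lfp x).toReal - (a x : ℝ)‖ ≤ ε ∧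
          ∀ x, ((Nat.size (a x).num + Nat.size (a x).den : ℕ) : ℝ) ≤
            K * (Real.log Δ.maxCondRuntime.toReal + Real.log (1 / Δ.minReturnProb.toReal)
              + Real.log (Fintype.card Q) + Real.log (Fintype.card Γ)
              + max 0 (Real.log (1 / ε)) + 1) := by
  classical
  -- The final estimate has constant term 19 and coefficients at most 8, so 40 is ample.
  refine ⟨40, fun Q Γ _ _ Δ hΔ ε hε => ?_⟩
  rw [Δ.lfp_eq_returnVec]
  have hQ : 0 ≤ Real.log (Fintype.card Q) := Real.log_natCast_nonneg _
  have hΓ : 0 ≤ Real.log (Fintype.card Γ) := Real.log_natCast_nonneg _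
  have hεlog : 0 ≤ max 0 (Real.log (1 / ε)) := le_max_left _ _
  by_cases hex : ∃ i, Δ.returnVec i ≠ 0
  swap
  -- Here the supremum is `0` and the infimum is `⊤`, both with real value `0`; their logarithmic
  -- terms vanish, as they would for `C = m = 1`. The zero vector works.
  · have h0 : ∀ i, Δ.returnVec i = 0 := by simpa using hex
    have hC : Δ.maxCondRuntime = 0 := by
      refine nonpos_iff_eq_zero.1 (iSup_le fun p => iSup_le fun Z => iSup_le fun q =>
        iSup_le fun h => absurd (h0 (p, Z, q)) h)
    have hm : Δ.minReturnProb = ⊤ := by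
      refine top_le_iff.1 (le_iInf fun p => le_iInf fun Z => le_iInf fun q =>
        le_iInf fun h => absurd (h0 (p, Z, q)) h)
    have hfix := Δ.fundamental_returnVec
    rw [show Δ.returnVec = fun _ => 0 from funext h0] at hfix
    refine ⟨fun _ => 0, ?_, Δ.returnVec_ne_top, ?_, fun x => ?_⟩
    · simpa using hfix.le
    · simpa [h0, ← Pi.zero_def] using hε.le
    · simp only [hC, hm, ENNReal.toReal_zero, ENNReal.toReal_top, Real.log_zero, div_zero,
        NNRat.num_zero, NNRat.den_zero, Nat.size_zero, Nat.size_one]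
      push_cast
      linarith
  obtain ⟨i₀, hi₀⟩ := hex
  set C : ℝ := Δ.maxCondRuntime.toReal with hC
  set m : ℝ := Δ.minReturnProb.toReal with hm
  have hC1 : 1 ≤ C := by
    rw [← ENNReal.toReal_one]
    exact ENNReal.toReal_mono hΔ.maxCondRuntime_ne_top (Δ.one_le_maxCondRuntime hi₀)
  have hmi : ∀ i, Δ.returnVec i ≠ 0 → m ≤ (Δ.returnVec i).toReal := fun i hi =>
    ENNReal.toReal_mono (Δ.returnVec_ne_top i) (Δ.minReturnProb_le hi)
  have hr1 : ∀ i, (Δ.returnVec i).toReal ≤ 1 := fun i =>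
    ENNReal.toReal_le_of_le_ofReal zero_le_one (by simpa using Δ.returnVec_le_one i)
  have hm1 : m ≤ 1 := (hmi i₀ hi₀).trans (hr1 i₀)
  have hm0 : 0 < m := ENNReal.toReal_pos Δ.minReturnProb_pos.ne'
    (ne_top_of_le_ne_top (Δ.returnVec_ne_top i₀) (Δ.minReturnProb_le hi₀))
  set M : ℝ := max 1 (1 / ε) with hM
  have hM1 : 1 ≤ M := le_max_left _ _
  have hMε : 1 ≤ M * ε := by
    rw [← div_le_iff₀ hε]
    exact le_max_right _ _
  have hlogM : Real.log M = max 0 (Real.log (1 / ε)) := by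
    rcases le_total (1 / ε) 1 with h | h
    · rw [hM, max_eq_left h, Real.log_one,
        max_eq_left (Real.log_nonpos (by positivity) h)]
    · rw [hM, max_eq_right h, max_eq_right (Real.log_nonneg h)]
  -- The factor `C ^ 2` keeps the second-order term within the slack; `M` brings the distance to the
  -- fixed point below `ε`.
  set η : ℝ := 1 / (6 * C ^ 2 * M) with hη
  have hη0 : 0 < η := by positivity
  have hηC : η * C ^ 2 ≤ 1 / 6 := by
    rw [hη, div_mul_eq_mul_div, div_le_div_iff₀ (by positivity) (by norm_num)]
    nlinarith [sq_nonneg C]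
  have hC2 : C ≤ C ^ 2 := by nlinarith
  have hη1 : η ≤ 1 / 6 := by nlinarith
  have hηε : 6 * η * C ≤ ε := by
    have : 6 * η * C ^ 2 * M = 1 := by rw [hη]; field_simp
    have h2 : 6 * η * C ^ 2 ≤ ε := by
      calc 6 * η * C ^ 2 ≤ 6 * η * C ^ 2 * (M * ε) :=
            le_mul_of_one_le_right (by positivity) hMε
        _ = 6 * η * C ^ 2 * M * ε := by ring
        _ = ε := by rw [this, one_mul]
    nlinarith
  -- The number `72 * C ^ 2 * M / m` is the inverse of the admissible rounding error `η / 12 * m`: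
  -- precision `n + 1` is fine enough, while `2 ^ n` is still bounded by it.
  obtain ⟨n, hn1, hn2⟩ := exists_nat_pow_near (x := 72 * C ^ 2 * M / m) (y := 2)
    (by rw [le_div_iff₀ hm0]; nlinarith [mul_le_mul (hC1.trans hC2) hM1 zero_le_one (by positivity)])
    one_lt_two
  have hstep : (1 : ℝ) / 2 ^ (n + 1) ≤ η / 12 * m := by
    rw [div_le_iff₀ (by positivity)]
    calc (1 : ℝ) = η / 12 * m * (72 * C ^ 2 * M / m) := by rw [hη]; field_simp; norm_num
      _ ≤ _ := by gcongr
  have hEt : ∀ i, Δ.momentVec i ≠ ⊤ := fun i => ne_top_of_le_ne_top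
    (ENNReal.mul_ne_top hΔ.maxCondRuntime_ne_top (Δ.returnVec_ne_top i)) (Δ.momentVec_le i)
  have hEC : ∀ i, (Δ.momentVec i).toReal ≤ C * (Δ.returnVec i).toReal := fun i => by
    rw [hC, ← ENNReal.toReal_mul]
    exact ENNReal.toReal_mono
      (ENNReal.mul_ne_top hΔ.maxCondRuntime_ne_top (Δ.returnVec_ne_top i)) (Δ.momentVec_le i)
  set w : Q × Γ × Q → ℝ := fun i => (Δ.returnVec i).toReal + η * (Δ.momentVec i).toReal with hw
  have hwof : ∀ i, Δ.returnVec i + ENNReal.ofReal η * Δ.momentVec i = ENNReal.ofReal (w i) := by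
    intro i
    rw [hw, ENNReal.ofReal_add ENNReal.toReal_nonneg (by positivity),
      ENNReal.ofReal_mul hη0.le, ENNReal.ofReal_toReal (Δ.returnVec_ne_top i),
      ENNReal.ofReal_toReal (hEt i)]
  have hw0 : ∀ i, 0 ≤ w i := fun i => by positivity
  have hwr : ∀ i, (Δ.returnVec i).toReal ≤ w i := fun i =>
    le_add_of_nonneg_right (by positivity)
  have hwC : ∀ i, w i ≤ (Δ.returnVec i).toReal + η * C := fun i => by
    have h1 := mul_le_mul_of_nonneg_left (hEC i) hη0.le
    have h2 := mul_le_mul_of_nonneg_left (hr1 i) (show 0 ≤ η * C by positivity)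
    simp only [hw]
    linarith
  have hηC' : η * C ≤ 1 / 6 := by nlinarith
  have key : ∀ i, ∃ a : ℚ≥0, w i ≤ a ∧ (a : ℝ) ≤ (1 + η / 12) * w i ∧
      Nat.size a.num + Nat.size a.den ≤ 2 * (n + 1) + 3 := by
    intro i
    -- A relative error leaves no room at a zero entry, which must stay exactly `0`; elsewhere `w i
    -- ≥ m` turns the absolute error into a relative one.
    by_cases hi : Δ.returnVec i = 0
    · refine ⟨0, ?_, ?_, ?_⟩
      · simp [hw, hi, Δ.momentVec_eq_zero hi]
      · simp [hw, hi, Δ.momentVec_eq_zero hi]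
      · simp
    · obtain ⟨a, h1, h2, h3⟩ := exists_nnrat_round_up (hw0 i)
        (by linarith [hwC i, hr1 i]) (n + 1)
      refine ⟨a, h1, h2.trans ?_, h3⟩
      have h4 : η / 12 * m ≤ η / 12 * w i := by
        gcongr
        exact (hmi i hi).trans (hwr i)
      linarith
  choose a ha1 ha2 ha3 using key
  have hcast : ∀ i, ((a i : ℝ≥0) : ℝ≥0∞) = ENNReal.ofReal (a i) := fun i => by
    have h : (((a i : ℝ≥0) : ℝ≥0) : ℝ) = (a i : ℝ) := by norm_cast
    rw [← h, ENNReal.ofReal_coe_nnreal]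
  refine ⟨a, hΔ.fundamental_le_self hη0.le hηC (fun i => ?_) (fun i => ?_),
    Δ.returnVec_ne_top, ?_, fun i => ?_⟩
  · rw [hwof, hcast]
    exact ENNReal.ofReal_le_ofReal (ha1 i)
  · rw [hwof, hcast, ← ENNReal.ofReal_mul (by positivity)]
    exact ENNReal.ofReal_le_ofReal (ha2 i)
  · rw [pi_norm_le_iff_of_nonneg hε.le]
    intro i
    have h1 := hwr i
    have h2 := ha1 i
    have h3 := ha2 i
    have h4 := hwC i
    have h5 := hr1 i
    have h6 : η ≤ η * C := le_mul_of_one_le_right hη0.le hC1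
    have h7 : η * w i ≤ η * 2 := mul_le_mul_of_nonneg_left (by linarith) hη0.le
    -- The error is at most `η * C` from the moment direction plus `η / 6` from rounding, since `w i
    -- ≤ 2`; the sum is below `6 * η * C ≤ ε`.
    rw [Real.norm_eq_abs, abs_sub_comm, abs_of_nonneg (by linarith)]
    linarith
  · have h1 : ((Nat.size (a i).num + Nat.size (a i).den : ℕ) : ℝ) ≤ 2 * n + 5 := by
      exact_mod_cast (ha3 i).trans (by omega)
    have h2 : n * Real.log 2 ≤ Real.log (72 * C ^ 2 * M / m) := by
      rw [← Real.log_pow]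
      exact Real.log_le_log (by positivity) hn1
    have h3 : Real.log (72 * C ^ 2 * M / m) =
        Real.log 72 + 2 * Real.log C + Real.log M + Real.log (1 / m) := by
      rw [div_eq_mul_one_div, Real.log_mul (by positivity) (by positivity),
        Real.log_mul (by positivity) (by positivity),
        Real.log_mul (by positivity) (by positivity), Real.log_pow]
      push_cast
      ring
    have h4 : Real.log 72 ≤ 7 * Real.log 2 := by
      have : Real.log (2 ^ 7) = 7 * Real.log 2 := by rw [Real.log_pow]; norm_num
      rw [← this]
      exact Real.log_le_log (by norm_num) (by norm_num)
    have h5 := Real.log_two_gt_d9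
    have h6 := Real.log_nonneg hC1
    have h7 : 0 ≤ Real.log (1 / m) := Real.log_nonneg (by rw [le_div_iff₀ hm0]; linarith)
    rw [hlogM] at h3
    -- Dividing by `log 2 > 1/2` at most doubles the coefficients; the case split makes `n - 7`
    -- non-negative where this is needed.
    have h8 : (n : ℝ) - 7 ≤ 4 * Real.log C + 2 * max 0 (Real.log (1 / ε))
        + 2 * Real.log (1 / m) := by
      rcases le_total (n : ℝ) 7 with h | h
      · linarith
      · nlinarith
    linarith
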